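/- Let $\mathbb K$ be $\mathbb R$ or $\mathbb C$. For a continuous linear operator $T:X\to X$ on a topological vector space $X$ and nonempty open sets $U,V\subseteq X$, put $N_T(U,V)=\{n\in\mathbb N: T^n(U)\cap V\neq\emptyset\}$. The operator $T$ is called frequently transitive if for all nonempty open sets $U,V\subseteq X$ the set $N_T(U,V)$ has positive lower density, i.e. $\liminf_{n\to\infty}\frac{\#\{j\le n:\ j\in N_T(U,V)\}}{n}>0$. The operator $T$ is called weakly mixing if $T\oplus T$ is hypercyclic on $X\oplus X$, i.e. if there is a pair $(x,y)\in X\oplus X$ whose orbit $\{(T^nx,T^ny):n\in\mathbb N\}$ meets every nonempty open subset of $X\oplus X$. Theorem. There exist an infinite-dimensional separable Fréchet space $X$ over $\mathbb K$ and a continuous linear operator $T:X\to X$ which is frequently transitive but not weakly mixing. -/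

import Mathlib

open Filter Topology

namespace LinearDynamics

section Spaces

variable (𝕜 X : Type*) [RCLike 𝕜] [AddCommGroup X] [Module 𝕜 X] [UniformSpace X]

/-- A Fréchet space over `𝕜 = ℝ` or `ℂ`: a complete Hausdorff topological vector space (with the
translation-invariant uniform structure of its additive group) whose topology is generated by a
countable family of seminorms. Continuity of scalar multiplication is a consequence of
`exists_seminorms`. -/
structure IsFrechetSpace : Prop where
  isUniformAddGroup : IsUniformAddGroup X
  exists_seminorms : ∃ p : ℕ → Seminorm 𝕜 X, WithSeminorms p
  t2Space : T2Space X
  completeSpace : CompleteSpace X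

end Spaces

/-- The lower density `liminf_n #{j ≤ n : j ∈ A} / n` of a set of natural numbers. -/
noncomputable def lowerDensity (A : Set ℕ) : ℝ :=
  liminf (fun n : ℕ => ((A ∩ Set.Iic n).ncard : ℝ) / (n : ℝ)) atTop

section Operators

variable {𝕜 X : Type*} [RCLike 𝕜] [AddCommGroup X] [Module 𝕜 X] [TopologicalSpace X]

/-- The return times `N_T(x, U) = {n : T^n x ∈ U}`. -/
def returnTimes (T : X →L[𝕜] X) (x : X) (U : Set X) : Set ℕ :=
  {n : ℕ | T^[n] x ∈ U}

/-- The hitting times `N_T(U, V) = {n : T^n(U) ∩ V ≠ ∅}`. -/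
def hittingTimes (T : X →L[𝕜] X) (U V : Set X) : Set ℕ :=
  {n : ℕ | (T^[n] '' U ∩ V).Nonempty}

/-- `T` is hypercyclic if the orbit of some vector meets every nonempty open set. -/
def IsHypercyclic (T : X →L[𝕜] X) : Prop :=
  ∃ x : X, ∀ U : Set X, IsOpen U → U.Nonempty → (returnTimes T x U).Nonempty

/-- `T` is weakly mixing if `T ⊕ T` is hypercyclic on `X ⊕ X`. -/
def IsWeaklyMixing (T : X →L[𝕜] X) : Prop :=
  IsHypercyclic (T.prodMap T)

/-- `T` is frequently transitive if all hitting times `N_T(U, V)` of nonempty open sets have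
positive lower density. -/
def IsFrequentlyTransitive (T : X →L[𝕜] X) : Prop :=
  ∀ U V : Set X, IsOpen U → U.Nonempty → IsOpen V → V.Nonempty →
    0 < lowerDensity (hittingTimes T U V)

end Operators

end LinearDynamics

namespace LinearDynamics

/-! Let V be the free `𝕜[z]`-module on generators e_0, e_1, …, with `single (n, m)` standing for z^m
e_n. A nonzero continuous bilinear form for which T is symmetric excludes weak mixing
(`not_isWeaklyMixing_of_bilinear`). The aim is to topologise V so that multiplication by z is
symmetric for such a form and still frequently transitive.

For transitivity, take p, q in a countable dense set and a precision K. For all n in a set of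
positive lower density (`exists_isAdmissible`), e_n is to be close to p and z^n e_n close to q, even
after multiplying the errors by z^l with l ≤ K.

The form allows this because it is defined recursively: against e_a with a ≤ n, the vector z^m e_n
pairs exactly as the combination of earlier generators it imitates. As the windows of active indices
are well separated, the errors pair to zero with one another (`form_smallSet`), and any adapted
basis vector pairs nontrivially with only finitely many of them (`finite_form_ne_zero`). Hence a
weighted ℓ¹ norm can make the errors as small as desired, with large weights elsewhere keeping the
form bounded (`exists_weight`).

Multiplication by z need not be continuous for that norm. Closing up the sequences (f, zf, z²f, …)
in a countable power of ℓ¹ gives a Fréchet space on which it becomes the backward shift. -/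

/-! ### Separated sets of positive lower density -/

theorem lowerDensity_pos_of_eventually {B : Set ℕ} {c : ℝ} (hc : 0 < c)
    (h : ∀ᶠ n : ℕ in atTop, c * n ≤ ((B ∩ Set.Iic n).ncard : ℝ)) : 0 < lowerDensity B := by
  refine hc.trans_le ?_
  unfold lowerDensity
  refine le_liminf_of_le ?_ ?_
  · refine IsBoundedUnder.isCoboundedUnder_ge ⟨2, ?_⟩
    rw [eventually_map]
    filter_upwards [eventually_ge_atTop 1] with n hn
    have hn' : (1 : ℝ) ≤ n := by exact_mod_cast hn
    rw [div_le_iff₀ (by linarith)]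
    have h1 : (B ∩ Set.Iic n).ncard ≤ n + 1 := by
      calc (B ∩ Set.Iic n).ncard ≤ (Set.Iic n).ncard :=
            Set.ncard_le_ncard Set.inter_subset_right (Set.finite_Iic n)
        _ = n + 1 := by rw [← Finset.coe_Iic, Set.ncard_coe_finset, Nat.card_Iic]
    have h2 : ((B ∩ Set.Iic n).ncard : ℝ) ≤ n + 1 := by exact_mod_cast h1
    linarith
  · filter_upwards [h, eventually_ge_atTop 1] with n h hn
    have hn' : (1 : ℝ) ≤ n := by exact_mod_cast hn
    rwa [le_div_iff₀ (by linarith)]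

/-- There is a colouring of `ℕ` all of whose colour classes have bounded gaps. -/
theorem exists_syndetic_coloring :
    ∃ lev : ℕ → ℕ, ∀ i, ∃ L, ∀ m, ∃ j, m ≤ j ∧ j < m + L ∧ lev j = i := by
  -- Colour by 2-adic valuation: colour i consists of the odd multiples of 2^i, which recur with
  -- period 2^(i+1).
  refine ⟨fun j => padicValNat 2 j, fun i => ⟨2 ^ (i + 1) * 2, fun m => ?_⟩⟩
  have hp : 0 < 2 ^ i := by positivity
  have h1 := Nat.div_add_mod m (2 ^ (i + 1))
  have h2 := Nat.mod_lt m (show 0 < 2 ^ (i + 1) by positivity)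
  have h3 : 2 ^ (i + 1) = 2 * 2 ^ i := by ring
  have h4 : 2 ^ i * (2 * (m / 2 ^ (i + 1) + 1) + 1)
      = 2 ^ (i + 1) * (m / 2 ^ (i + 1)) + 2 ^ (i + 1) + 2 ^ i := by ring
  refine ⟨2 ^ i * (2 * (m / 2 ^ (i + 1) + 1) + 1), by omega, by omega, ?_⟩
  change padicValNat 2 (2 ^ i * (2 * (m / 2 ^ (i + 1) + 1) + 1)) = i
  rw [padicValNat.mul hp.ne' (by omega), padicValNat.prime_pow,
    padicValNat.eq_zero_of_not_dvd (by omega), add_zero]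

theorem le_two_pow_add (j : ℕ) : 8 * j ≤ 2 ^ j + 20 := by
  induction j with
  | zero => simp
  | succ j ih =>
    rcases Nat.lt_or_ge j 3 with h | h
    · interval_cases j <;> norm_num
    · have : 2 ^ 3 ≤ 2 ^ j := Nat.pow_le_pow_right (by norm_num) h
      have h2 : 2 ^ (j + 1) = 2 * 2 ^ j := by ring
      omega

/-- The part of colour `i` in the dyadic blocks of colour `i`, beyond the threshold `J i`. -/
def levelSet (lev J : ℕ → ℕ) (i : ℕ) : Set ℕ :=
  {n | ∃ j t, lev j = i ∧ J i ≤ j ∧ i + 3 ≤ j ∧ n = 2 ^ j + t * (2 * i + 1) ∧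
    2 * (t * (2 * i + 1)) < 2 ^ j}

/-- Within a block the step 2i+1 exceeds 2i. Between blocks, only the first half of each [2^j,
2^(j+1)) is used, leaving a gap of more than 2^j'/4 before the later block j'; this beats i + i'
because i ≤ j - 3 and i' ≤ j' - 3. -/
theorem levelSet_separated {lev J : ℕ → ℕ} {i i' n n' : ℕ} (hn : n ∈ levelSet lev J i)
    (hn' : n' ∈ levelSet lev J i') (h : n < n') : n + i + i' < n' := by
  obtain ⟨j, t, hj, -, hij, rfl, ht⟩ := hn
  obtain ⟨j', t', hj', -, hij', rfl, ht'⟩ := hn'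
  rcases lt_trichotomy j j' with hlt | rfl | hlt
  · have h1 : 2 ^ (j + 1) ≤ 2 ^ j' := Nat.pow_le_pow_right (by norm_num) hlt
    have h2 : 2 ^ (j + 1) = 2 * 2 ^ j := by ring
    have h3 := le_two_pow_add j'
    omega
  · obtain rfl : i = i' := hj.symm.trans hj'
    have h1 : t < t' := by
      by_contra! hle
      have := Nat.mul_le_mul_right (2 * i + 1) hle
      omega
    have h2 : (t + 1) * (2 * i + 1) ≤ t' * (2 * i + 1) := Nat.mul_le_mul_right _ h1
    have h3 : (t + 1) * (2 * i + 1) = t * (2 * i + 1) + (2 * i + 1) := by ring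
    omega
  · have h1 : 2 ^ (j' + 1) ≤ 2 ^ j := Nat.pow_le_pow_right (by norm_num) hlt
    have h2 : 2 ^ (j' + 1) = 2 * 2 ^ j' := by ring
    omega

theorem levelSet_disjoint {lev J : ℕ → ℕ} {i i' n : ℕ} (hn : n ∈ levelSet lev J i)
    (hn' : n ∈ levelSet lev J i') : i = i' := by
  obtain ⟨j, t, hj, -, hij, rfl, ht⟩ := hn
  obtain ⟨j', t', hj', -, hij', heq, ht'⟩ := hn'
  rcases lt_trichotomy j j' with hlt | rfl | hlt
  · have h1 : 2 ^ (j + 1) ≤ 2 ^ j' := Nat.pow_le_pow_right (by norm_num) hlt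
    have h2 : 2 ^ (j + 1) = 2 * 2 ^ j := by ring
    omega
  · exact hj.symm.trans hj'
  · have h1 : 2 ^ (j' + 1) ≤ 2 ^ j := Nat.pow_le_pow_right (by norm_num) hlt
    have h2 : 2 ^ (j' + 1) = 2 * 2 ^ j' := by ring
    omega

theorem lt_of_mem_levelSet {lev J : ℕ → ℕ} {i n : ℕ} (hn : n ∈ levelSet lev J i) :
    J i < n ∧ 2 * i < n := by
  obtain ⟨j, t, hj, hJ, hij, rfl, ht⟩ := hn
  have h1 : j < 2 ^ j := Nat.lt_two_pow_self
  have h2 := le_two_pow_add j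
  omega

/-- Below any large n there is a block of colour i whose length is a fixed fraction of n, since
colour i recurs within L consecutive exponents; the progression of step 2i+1 fills a fixed fraction
of it. -/
theorem lowerDensity_pos_of_levelSet {lev : ℕ → ℕ} {i L : ℕ}
    (hL : ∀ m, ∃ j, m ≤ j ∧ j < m + L ∧ lev j = i) (J : ℕ → ℕ) (N : ℕ) {B : Set ℕ}
    (hB : ∀ n ∈ levelSet lev J i, N ≤ n → n ∈ B) : 0 < lowerDensity B := by
  have hq : (0 : ℝ) < 8 * i + 4 := by positivity
  refine lowerDensity_pos_of_eventually (c := 1 / ((8 * i + 4) * 2 ^ (L + 1))) (by positivity) ?_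
  set j₀ := J i + (i + 3) + N with hj₀
  filter_upwards [eventually_ge_atTop (2 ^ (j₀ + L))] with n hn
  have hn0 : n ≠ 0 := by have : 0 < 2 ^ (j₀ + L) := by positivity
                         omega
  have hlog : j₀ + L ≤ Nat.log 2 n := Nat.le_log_of_pow_le (by norm_num) hn
  obtain ⟨j, hj1, hj2, hlev⟩ := hL (Nat.log 2 n - L)
  have hj3 : j + 1 ≤ Nat.log 2 n := by omega
  have hle : 2 * 2 ^ j ≤ n := by
    calc 2 * 2 ^ j = 2 ^ (j + 1) := by ring
      _ ≤ 2 ^ Nat.log 2 n := Nat.pow_le_pow_right (by norm_num) hj3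
      _ ≤ n := Nat.pow_log_le_self 2 hn0
  have hlt : n < 2 ^ j * 2 ^ (L + 1) := by
    calc n < 2 ^ (Nat.log 2 n + 1) := Nat.lt_pow_succ_log_self (by norm_num) n
      _ ≤ 2 ^ (j + (L + 1)) := Nat.pow_le_pow_right (by norm_num) (by omega)
      _ = _ := by ring
  have hbig : 4 * i + 2 ≤ 2 ^ j := by
    have h1 : 2 ^ (i + 3) ≤ 2 ^ j := Nat.pow_le_pow_right (by norm_num) (by omega)
    have h2 : i < 2 ^ i := Nat.lt_two_pow_self
    have h3 : 2 ^ (i + 3) = 8 * 2 ^ i := by ring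
    omega
  set c := 2 ^ j / (4 * i + 2) with hc
  have hcard : c ≤ (B ∩ Set.Iic n).ncard := by
    have hsub : (fun t => 2 ^ j + t * (2 * i + 1)) '' (Set.Iio c) ⊆ B ∩ Set.Iic n := by
      rintro _ ⟨t, ht, rfl⟩
      have ht' : t < c := ht
      have h1 : (t + 1) * (4 * i + 2) ≤ 2 ^ j :=
        (Nat.mul_le_mul_right _ ht').trans (Nat.div_mul_le_self _ _)
      have h3 : (t + 1) * (4 * i + 2) = 2 * (t * (2 * i + 1)) + (4 * i + 2) := by ring
      have h4 : j < 2 ^ j := Nat.lt_two_pow_self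
      exact ⟨hB _ ⟨j, t, hlev, by omega, by omega, rfl, by omega⟩ (by dsimp only; omega),
        show 2 ^ j + t * (2 * i + 1) ≤ n by omega⟩
    have hinj : Function.Injective (fun t => 2 ^ j + t * (2 * i + 1)) := by
      intro a b hab
      have : a * (2 * i + 1) = b * (2 * i + 1) := by simpa using hab
      exact Nat.eq_of_mul_eq_mul_right (by omega) this
    calc c = (Set.Iio c).ncard := by rw [← Finset.coe_Iio, Set.ncard_coe_finset, Nat.card_Iio]
      _ = _ := (Set.ncard_image_of_injective _ hinj).symm
      _ ≤ _ := Set.ncard_le_ncard hsub ((Set.finite_Iic n).subset Set.inter_subset_right)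
  -- Rounding down in `c` costs at most a factor 2, because the quotient is at least 1.
  have hc2 : 2 ^ j ≤ c * (8 * i + 4) := by
    have h1 := Nat.div_add_mod (2 ^ j) (4 * i + 2)
    have h2 := Nat.mod_lt (2 ^ j) (show 0 < 4 * i + 2 by omega)
    have h3 : 1 ≤ c := (Nat.one_le_div_iff (by omega)).2 hbig
    have h4 : (4 * i + 2) * 1 ≤ (4 * i + 2) * c := Nat.mul_le_mul_left _ h3
    have h5 : c * (8 * i + 4) = (4 * i + 2) * c + (4 * i + 2) * c := by ring
    rw [← hc] at h1
    omega
  have hfin : n ≤ (B ∩ Set.Iic n).ncard * ((8 * i + 4) * 2 ^ (L + 1)) := by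
    calc n ≤ 2 ^ j * 2 ^ (L + 1) := hlt.le
      _ ≤ (c * (8 * i + 4)) * 2 ^ (L + 1) := Nat.mul_le_mul_right _ hc2
      _ = c * ((8 * i + 4) * 2 ^ (L + 1)) := by ring
      _ ≤ _ := Nat.mul_le_mul_right _ hcard
  rw [div_mul_eq_mul_div, one_mul, div_le_iff₀ (by positivity)]
  exact_mod_cast hfin

/-! ### The recursive symmetric form and its adapted basis -/

section Form

variable {𝕜 : Type*} [Field 𝕜]

/-- The shift `single (a, l) ↦ single (a, l + 1)`: multiplication by the variable on the free
`𝕜[z]`-module with basis `(single (a, 0))`. -/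
noncomputable def shift : (ℕ × ℕ →₀ 𝕜) →ₗ[𝕜] (ℕ × ℕ →₀ 𝕜) :=
  Finsupp.lmapDomain 𝕜 𝕜 fun e => (e.1, e.2 + 1)

@[simp] theorem shift_single (a l : ℕ) (c : 𝕜) :
    shift (Finsupp.single (a, l) c) = Finsupp.single (a, l + 1) c := by
  simp [shift]

@[simp] theorem shift_pow_single (m a l : ℕ) (c : 𝕜) :
    (shift ^ m) (Finsupp.single (a, l) c) = Finsupp.single (a, l + m) c := by
  induction m with
  | zero => simp
  | succ m ih => rw [pow_succ', Module.End.mul_apply, ih, shift_single, add_assoc]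

variable (P Q : ℕ → (ℕ × ℕ →₀ 𝕜))

/-- The combination of generators of smaller index that `single (n, m)` is made to imitate. -/
noncomputable def reduct (n m : ℕ) : ℕ × ℕ →₀ 𝕜 :=
  if m < n then (shift ^ m) (P n) else (shift ^ (m - n)) (Q n)

/-- The value of the bilinear form at `(single (a, l), single (b, l'))`, where `m = l + l'`. -/
noncomputable def formCoeff (a b m : ℕ) : 𝕜 :=
  if max a b = 0 then 1 else
    (reduct P Q (max a b) m).sum fun e c =>
      -- The guard is there for termination; it always holds when `P` and `Q` are lower.
      if _h : e.1 < max a b then c * formCoeff (min a b) e.1 e.2 else 0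
termination_by a + b
decreasing_by
  have := max_add_min a b
  omega

theorem formCoeff_zero (m : ℕ) : formCoeff P Q 0 0 m = 1 := by
  rw [formCoeff]; simp

theorem formCoeff_comm (a b m : ℕ) : formCoeff P Q a b m = formCoeff P Q b a m := by
  rw [formCoeff, formCoeff, max_comm, min_comm]

/-- The bilinear form with coefficients `formCoeff`. -/
noncomputable def form : (ℕ × ℕ →₀ 𝕜) →ₗ[𝕜] (ℕ × ℕ →₀ 𝕜) →ₗ[𝕜] 𝕜 :=
  Finsupp.linearCombination 𝕜 fun e =>
    Finsupp.linearCombination 𝕜 fun e' => formCoeff P Q e.1 e'.1 (e.2 + e'.2)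

theorem form_single_single (a l b m : ℕ) (c d : 𝕜) :
    form P Q (Finsupp.single (a, l) c) (Finsupp.single (b, m) d)
      = c * (d * formCoeff P Q a b (l + m)) := by
  simp [form]

theorem form_comm (f g : ℕ × ℕ →₀ 𝕜) : form P Q f g = form P Q g f := by
  have : form P Q = (form P Q).flip := by
    ext ⟨a, l⟩ ⟨b, m⟩
    simp [form, formCoeff_comm P Q a b, add_comm]
  conv_lhs => rw [this]
  rfl

/-- The coefficients depend on the two degrees only through their sum. -/
theorem form_shift (f g : ℕ × ℕ →₀ 𝕜) : form P Q (shift f) g = form P Q f (shift g) := by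
  have : (form P Q).comp shift = ((form P Q).flip.comp shift).flip := by
    ext ⟨a, l⟩ ⟨b, m⟩
    simp [form_single_single, add_assoc, add_comm 1 m]
  exact LinearMap.congr_fun₂ this f g

theorem form_shift_pow (j : ℕ) (f g : ℕ × ℕ →₀ 𝕜) :
    form P Q ((shift ^ j) f) g = form P Q f ((shift ^ j) g) := by
  induction j generalizing f with
  | zero => simp
  | succ j ih => rw [pow_succ, Module.End.mul_apply, ih, form_shift, ← Module.End.mul_apply,
      ← pow_succ', ← pow_succ]

variable {P Q}

/-- For each `n`, the vector `P n` involves only generators of index less than `n`. -/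
def IsLower (P : ℕ → (ℕ × ℕ →₀ 𝕜)) : Prop := ∀ n, ∀ e ∈ (P n).support, e.1 < n

theorem exists_of_mem_support_shift_pow {j : ℕ} {f : ℕ × ℕ →₀ 𝕜} {e : ℕ × ℕ}
    (he : e ∈ ((shift ^ j) f).support) : ∃ e' ∈ f.support, e = (e'.1, e'.2 + j) := by
  classical
  induction j generalizing e with
  | zero => exact ⟨e, by simpa using he, rfl⟩
  | succ j ih =>
    rw [pow_succ', Module.End.mul_apply] at he
    obtain ⟨e₁, he₁, rfl⟩ := Finset.mem_image.1 (Finsupp.mapDomain_support he)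
    obtain ⟨e', he', rfl⟩ := ih he₁
    exact ⟨e', he', rfl⟩

theorem lt_of_mem_support_reduct (hP : IsLower P) (hQ : IsLower Q) {n m : ℕ} {e : ℕ × ℕ}
    (he : e ∈ (reduct P Q n m).support) : e.1 < n := by
  unfold reduct at he
  split_ifs at he
  · obtain ⟨e', he', rfl⟩ := exists_of_mem_support_shift_pow he
    exact hP n e' he'
  · obtain ⟨e', he', rfl⟩ := exists_of_mem_support_shift_pow he
    exact hQ n e' he'

theorem formCoeff_eq (hP : IsLower P) (hQ : IsLower Q) {a n : ℕ} (han : a ≤ n) (hn : n ≠ 0)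
    (m : ℕ) : formCoeff P Q a n m = form P Q (Finsupp.single (a, 0) 1) (reduct P Q n m) := by
  rw [formCoeff, max_eq_right han, min_eq_left han, if_neg hn]
  conv_rhs => rw [form, Finsupp.linearCombination_single, one_smul, Finsupp.linearCombination_apply]
  refine Finset.sum_congr rfl fun e he => ?_
  dsimp only
  rw [dif_pos (lt_of_mem_support_reduct hP hQ he), zero_add, smul_eq_mul]

/-- The basis of the module adapted to the form. -/
noncomputable def basisVec (P Q : ℕ → (ℕ × ℕ →₀ 𝕜)) (e : ℕ × ℕ) : ℕ × ℕ →₀ 𝕜 :=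
  Finsupp.single e 1 - reduct P Q e.1 e.2

theorem form_single_sub_reduct (hP : IsLower P) (hQ : IsLower Q) {a n : ℕ} (han : a ≤ n)
    (hn : n ≠ 0) (m : ℕ) :
    form P Q (Finsupp.single (a, 0) 1) (basisVec P Q (n, m)) = 0 := by
  rw [basisVec, map_sub, form_single_single, zero_add, formCoeff_eq hP hQ han hn]
  simp

/-- Shifting commutes with `reduct` as long as the degree does not cross n, where the imitated
vector switches from `P n` to `Q n`. This is the only obstruction to orthogonality. -/
theorem basisVec_eq_shift_of_lt {n m l : ℕ} (h : m + l < n) :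
    (shift ^ l) (basisVec P Q (n, m)) = basisVec P Q (n, m + l) := by
  simp only [basisVec, map_sub, shift_pow_single, sub_right_inj]
  rw [reduct, reduct, if_pos h, if_pos (by omega), ← Module.End.mul_apply, ← pow_add, add_comm]

theorem basisVec_eq_shift_of_le {n m l : ℕ} (h : n ≤ m) :
    (shift ^ l) (basisVec P Q (n, m)) = basisVec P Q (n, m + l) := by
  simp only [basisVec, map_sub, shift_pow_single, sub_right_inj]
  rw [reduct, reduct, if_neg (by omega), if_neg (by omega), ← Module.End.mul_apply, ← pow_add]
  congr 2
  omega

/-- Symmetry moves z^l to the second argument, where it stays on the same side of the switch at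
degree n. -/
theorem form_single_basisVec_of_lt (hP : IsLower P) (hQ : IsLower Q) {a l n m : ℕ} (han : a ≤ n)
    (h : l + m < n) : form P Q (Finsupp.single (a, l) 1) (basisVec P Q (n, m)) = 0 := by
  have h1 : (Finsupp.single (a, l) 1 : ℕ × ℕ →₀ 𝕜) = (shift ^ l) (Finsupp.single (a, 0) 1) := by
    simp
  rw [h1, form_shift_pow, basisVec_eq_shift_of_lt (by omega),
    form_single_sub_reduct hP hQ han (by omega)]

theorem form_single_basisVec_of_le (hP : IsLower P) (hQ : IsLower Q) {a l n m : ℕ} (han : a ≤ n)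
    (hn : n ≠ 0) (h : n ≤ m) :
    form P Q (Finsupp.single (a, l) 1) (basisVec P Q (n, m)) = 0 := by
  have h1 : (Finsupp.single (a, l) 1 : ℕ × ℕ →₀ 𝕜) = (shift ^ l) (Finsupp.single (a, 0) 1) := by
    simp
  rw [h1, form_shift_pow, basisVec_eq_shift_of_le h, form_single_sub_reduct hP hQ han hn]

theorem form_eq_zero_of_support {f g : ℕ × ℕ →₀ 𝕜}
    (h : ∀ e ∈ f.support, form P Q (Finsupp.single e 1) g = 0) : form P Q f g = 0 := by
  rw [← f.sum_single, Finsupp.sum, map_sum, LinearMap.sum_apply]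
  refine Finset.sum_eq_zero fun e he => ?_
  have : (Finsupp.single e (f e) : ℕ × ℕ →₀ 𝕜) = f e • Finsupp.single e 1 := by simp
  rw [this, map_smul, LinearMap.smul_apply, h e he, smul_zero]

theorem mem_support_basisVec {e d : ℕ × ℕ} (h : d ∈ (basisVec P Q e).support) :
    d = e ∨ d ∈ (reduct P Q e.1 e.2).support := by
  classical
  rcases Finset.mem_union.1 (Finsupp.support_sub h) with h | h
  · exact Or.inl (Finset.mem_singleton.1 (Finsupp.support_single_subset h))
  · exact Or.inr h

/-- Synthesis: the linear map sending `single e` to the adapted basis vector `basisVec e`. -/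
noncomputable def synth (P Q : ℕ → (ℕ × ℕ →₀ 𝕜)) : (ℕ × ℕ →₀ 𝕜) →ₗ[𝕜] (ℕ × ℕ →₀ 𝕜) :=
  Finsupp.linearCombination 𝕜 (basisVec P Q)

@[simp] theorem synth_single (e : ℕ × ℕ) (c : 𝕜) :
    synth P Q (Finsupp.single e c) = c • basisVec P Q e := by
  simp [synth]

/-- The coordinates of `single (n, m)` in the adapted basis. -/
noncomputable def coordVec (P Q : ℕ → (ℕ × ℕ →₀ 𝕜)) (n m : ℕ) : ℕ × ℕ →₀ 𝕜 :=
  Finsupp.single (n, m) 1 + (reduct P Q n m).sum fun e c =>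
    if _h : e.1 < n then c • coordVec P Q e.1 e.2 else 0
termination_by n

/-- Analysis: the coordinates in the adapted basis. -/
noncomputable def coords (P Q : ℕ → (ℕ × ℕ →₀ 𝕜)) : (ℕ × ℕ →₀ 𝕜) →ₗ[𝕜] (ℕ × ℕ →₀ 𝕜) :=
  Finsupp.linearCombination 𝕜 fun e => coordVec P Q e.1 e.2

theorem coordVec_eq (hP : IsLower P) (hQ : IsLower Q) (n m : ℕ) :
    coordVec P Q n m = Finsupp.single (n, m) 1 + coords P Q (reduct P Q n m) := by
  rw [coordVec, coords, Finsupp.linearCombination_apply]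
  congr 1
  refine Finset.sum_congr rfl fun e he => ?_
  dsimp only
  rw [dif_pos (lt_of_mem_support_reduct hP hQ he)]

theorem coords_basisVec (hP : IsLower P) (hQ : IsLower Q) (e : ℕ × ℕ) :
    coords P Q (basisVec P Q e) = Finsupp.single e 1 := by
  rw [basisVec, map_sub, sub_eq_iff_eq_add]
  conv_lhs => rw [coords]
  rw [Finsupp.linearCombination_single, one_smul, coordVec_eq hP hQ]

theorem synth_coordVec (hP : IsLower P) (hQ : IsLower Q) (n m : ℕ) :
    synth P Q (coordVec P Q n m) = Finsupp.single (n, m) 1 := by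
  induction n using Nat.strong_induction_on generalizing m with
  | _ n ih =>
    rw [coordVec_eq hP hQ, map_add, synth_single, one_smul, basisVec, sub_add_eq_add_sub,
      sub_eq_iff_eq_add, add_right_inj, coords, Finsupp.linearCombination_apply, Finsupp.sum,
      map_sum]
    conv_rhs => rw [← (reduct P Q n m).sum_single, Finsupp.sum]
    refine Finset.sum_congr rfl fun e he => ?_
    rw [map_smul, ih e.1 (lt_of_mem_support_reduct hP hQ he), Finsupp.smul_single, smul_eq_mul,
      mul_one]

theorem synth_coords (hP : IsLower P) (hQ : IsLower Q) (f : ℕ × ℕ →₀ 𝕜) :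
    synth P Q (coords P Q f) = f := by
  have : (synth P Q).comp (coords P Q) = LinearMap.id := by
    ext1 e
    ext1
    simp [coords, synth_coordVec hP hQ]
  exact LinearMap.congr_fun this f

end Form

/-! ### Orthogonality of the error vectors -/

section Admissible

variable {𝕜 : Type*} [Field 𝕜] {P Q : ℕ → (ℕ × ℕ →₀ 𝕜)} {act : Set ℕ} {k : ℕ → ℕ}

/-- At the active indices `n`, the data `P n` and `Q n` have low degree compared with `n`, and the
windows of width `k n` after the active indices are well separated. -/
structure IsAdmissible (P Q : ℕ → (ℕ × ℕ →₀ 𝕜)) (act : Set ℕ) (k : ℕ → ℕ) : Prop where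
  isLower_left : IsLower P
  isLower_right : IsLower Q
  degree_left : ∀ n ∈ act, ∀ e ∈ (P n).support, e.2 + 2 * k n < n
  degree_right : ∀ n ∈ act, ∀ e ∈ (Q n).support, e.2 + 2 * k n < n
  separated : ∀ n ∈ act, ∀ n' ∈ act, n < n' → n + k n + k n' < n'
  window_lt : ∀ n ∈ act, 2 * k n < n

/-- The indices of the adapted basis vectors that are to be small. -/
def smallSet (act : Set ℕ) (k : ℕ → ℕ) : Set (ℕ × ℕ) :=
  {e | e.1 ∈ act ∧ (e.2 ≤ k e.1 ∨ e.1 ≤ e.2 ∧ e.2 ≤ e.1 + k e.1)}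

theorem fst_le_of_mem_support_basisVec (hP : IsLower P) (hQ : IsLower Q) {d e : ℕ × ℕ}
    (h : d ∈ (basisVec P Q e).support) : d.1 ≤ e.1 := by
  rcases mem_support_basisVec h with rfl | h
  · exact le_rfl
  · exact (lt_of_mem_support_reduct hP hQ h).le

namespace IsAdmissible

theorem form_basisVec_eq_zero_of_le (h : IsAdmissible P Q act k) {d e : ℕ × ℕ} (hde : d.1 ≤ e.1)
    (he0 : e.1 ≠ 0) (he : e.1 ≤ e.2) : form P Q (basisVec P Q d) (basisVec P Q e) = 0 :=
  form_eq_zero_of_support fun _ hc =>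
    form_single_basisVec_of_le h.isLower_left h.isLower_right
      ((fst_le_of_mem_support_basisVec h.isLower_left h.isLower_right hc).trans hde) he0 he

theorem snd_lt_of_mem_support (h : IsAdmissible P Q act k) {d e : ℕ × ℕ} (he : e.1 ∈ act)
    (hu : e.2 ≤ k e.1) (hd : d ∈ (basisVec P Q e).support) : d.2 + k e.1 < e.1 := by
  have h1 := h.window_lt _ he
  rcases mem_support_basisVec hd with rfl | hd
  · omega
  · rw [reduct, if_pos (by omega)] at hd
    obtain ⟨c, hc, rfl⟩ := exists_of_mem_support_shift_pow hd
    have := h.degree_left _ he c hc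
    dsimp only
    omega

theorem snd_le_of_mem_support (h : IsAdmissible P Q act k) {d e : ℕ × ℕ}
    (he : e ∈ smallSet act k) (hd : d ∈ (basisVec P Q e).support) : d.2 ≤ e.1 + k e.1 := by
  obtain ⟨hact, hu | ⟨hv, hv'⟩⟩ := he
  · have := h.snd_lt_of_mem_support hact hu hd
    omega
  · rcases mem_support_basisVec hd with rfl | hd
    · exact hv'
    · rw [reduct, if_neg (by omega)] at hd
      obtain ⟨c, hc, rfl⟩ := exists_of_mem_support_shift_pow hd
      have := h.degree_right _ hact c hc
      dsimp only
      omega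

/-- Order so that d.1 ≤ e.1. If e lies past the switch, orthogonality is unconditional. If e lies in
the initial window, separation (for d.1 < e.1) or the degree bounds (for d.1 = e.1) keep the total
degree below e.1. -/
theorem form_smallSet (h : IsAdmissible P Q act k) {d e : ℕ × ℕ} (hd : d ∈ smallSet act k)
    (he : e ∈ smallSet act k) : form P Q (basisVec P Q d) (basisVec P Q e) = 0 := by
  wlog hde : d.1 ≤ e.1 generalizing d e
  · rw [form_comm]
    exact this he hd (by omega)
  have hkd := h.window_lt _ hd.1
  have hke := h.window_lt _ he.1
  rcases he.2 with hu | ⟨hv, -⟩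
  · rcases hde.lt_or_eq with hlt | heq
    · refine form_eq_zero_of_support fun c hc => ?_
      have h1 := h.snd_le_of_mem_support hd hc
      have h2 := fst_le_of_mem_support_basisVec h.isLower_left h.isLower_right hc
      have h3 := h.separated _ hd.1 _ he.1 hlt
      exact form_single_basisVec_of_lt h.isLower_left h.isLower_right (by omega) (by omega)
    · rcases hd.2 with hu' | ⟨hv', -⟩
      · refine form_eq_zero_of_support fun c hc => ?_
        have h1 := h.snd_lt_of_mem_support hd.1 hu' hc
        have h2 := fst_le_of_mem_support_basisVec h.isLower_left h.isLower_right hc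
        rw [heq] at h1
        exact form_single_basisVec_of_lt h.isLower_left h.isLower_right (by omega) (by omega)
      · rw [form_comm]
        exact h.form_basisVec_eq_zero_of_le heq.ge (by omega) hv'
  · exact h.form_basisVec_eq_zero_of_le hde (by omega) hv

/-- Once e.1 is large compared with d.1 and the degrees in `basisVec P Q d`, the total degree stays
below e.1, as 2 * k e.1 < e.1. -/
theorem finite_form_ne_zero (h : IsAdmissible P Q act k) (d : ℕ × ℕ) :
    {e ∈ smallSet act k | form P Q (basisVec P Q d) (basisVec P Q e) ≠ 0}.Finite := by
  set R := (basisVec P Q d).support.sup Prod.snd with hR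
  refine ((Set.finite_Iic (d.1 + 2 * R)).prod
    (Set.finite_Iic (2 * (d.1 + 2 * R)))).subset ?_
  rintro e ⟨he, hne⟩
  have hke := h.window_lt _ he.1
  have key : e.1 ≤ d.1 + 2 * R := by
    by_contra! hlt
    refine hne ?_
    rcases he.2 with hu | ⟨hv, -⟩
    · refine form_eq_zero_of_support fun c hc => ?_
      have h1 : c.2 ≤ R := Finset.le_sup (f := Prod.snd) hc
      have h2 := fst_le_of_mem_support_basisVec h.isLower_left h.isLower_right hc
      exact form_single_basisVec_of_lt h.isLower_left h.isLower_right (by omega) (by omega)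
    · exact h.form_basisVec_eq_zero_of_le (by omega) (by omega) hv
  refine ⟨key, ?_⟩
  change e.2 ≤ 2 * (d.1 + 2 * R)
  rcases he.2 with hu | ⟨-, hv⟩ <;> omega

end IsAdmissible

end Admissible

/-! ### Weights dominating the form -/

/-- A countable symmetric matrix which vanishes on `S × S` and whose rows are finite on `S` is
dominated by a rank one matrix `w ⊗ w`, with `w` prescribed on `S`. -/
theorem exists_weight {ι : Type*} [Countable ι] (b : ι → ι → ℝ) (hb : ∀ i j, 0 ≤ b i j)
    (hsymm : ∀ i j, b i j = b j i) (S : Set ι) (hS : ∀ i ∈ S, ∀ j ∈ S, b i j = 0)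
    (hfin : ∀ i, {j ∈ S | b i j ≠ 0}.Finite) (ε : ι → ℝ) (hε : ∀ i, 0 < ε i) :
    ∃ w : ι → ℝ, (∀ i, 0 < w i) ∧ (∀ i ∈ S, w i = ε i) ∧ ∀ i j, b i j ≤ w i * w j := by
  classical
  obtain ⟨φ, hφ⟩ := exists_injective_nat ι
  have hfin' : ∀ i, {j | φ j ≤ φ i}.Finite := fun i =>
    (Set.finite_Iic (φ i)).preimage hφ.injOn
  -- The weight off S: the first sum handles pairs with one index in S, the second handles pairs
  -- outside S, charging each to the index that comes later in the enumeration φ.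
  set M : ι → ℝ := fun i =>
    1 + ∑ j ∈ (hfin i).toFinset, b i j / ε j + ∑ j ∈ (hfin' i).toFinset, b i j with hM
  have hpos1 : ∀ i, 0 ≤ ∑ j ∈ (hfin i).toFinset, b i j / ε j := fun i =>
    Finset.sum_nonneg fun j _ => div_nonneg (hb i j) (hε j).le
  have hpos2 : ∀ i, 0 ≤ ∑ j ∈ (hfin' i).toFinset, b i j := fun i =>
    Finset.sum_nonneg fun j _ => hb i j
  have hM1 : ∀ i, 1 ≤ M i := fun i => by
    have := hpos1 i
    have := hpos2 i
    simp only [hM]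
    linarith
  have hMS : ∀ i, ∀ j ∈ S, b i j ≤ M i * ε j := fun i j hj => by
    by_cases h0 : b i j = 0
    · rw [h0]
      exact mul_nonneg (zero_le_one.trans (hM1 i)) (hε j).le
    rw [← div_le_iff₀ (hε j)]
    have h1 : b i j / ε j ≤ ∑ j ∈ (hfin i).toFinset, b i j / ε j :=
      Finset.single_le_sum (f := fun j => b i j / ε j)
        (fun j _ => div_nonneg (hb i j) (hε j).le) (by simp [hj, h0])
    have := hpos2 i
    simp only [hM]
    linarith
  have hMM : ∀ i j, φ j ≤ φ i → b i j ≤ M i * M j := fun i j hij => by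
    have h1 : b i j ≤ ∑ j ∈ (hfin' i).toFinset, b i j :=
      Finset.single_le_sum (f := fun j => b i j) (fun j _ => hb i j) (by simp [hij])
    have h2 : b i j ≤ M i := by
      have := hpos1 i
      simp only [hM]
      linarith
    nlinarith [hM1 i, hM1 j]
  refine ⟨fun i => if i ∈ S then ε i else M i, fun i => ?_, fun i hi => if_pos hi, fun i j => ?_⟩
  · dsimp only
    split_ifs
    exacts [hε i, zero_lt_one.trans_le (hM1 i)]
  · dsimp only
    split_ifs with hi hj hj
    · rw [hS i hi j hj]
      exact mul_nonneg (hε i).le (hε j).le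
    · rw [hsymm, mul_comm]
      exact hMS j i hi
    · exact hMS i j hj
    · rcases le_total (φ j) (φ i) with h | h
      · exact hMM i j h
      · rw [hsymm, mul_comm]
        exact hMM j i h

/-! ### Operators and bilinear forms on ℓ¹ -/

section LOne

variable {𝕜 ι : Type*} [RCLike 𝕜]

theorem summable_norm_lp_one (x : lp (fun _ : ι => 𝕜) 1) : Summable fun i => ‖x i‖ := by
  simpa using (memℓp_gen_iff (by norm_num)).1 (lp.memℓp x)

theorem norm_lp_one (x : lp (fun _ : ι => 𝕜) 1) : ‖x‖ = ∑' i, ‖x i‖ := by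
  simp [lp.norm_eq_tsum_rpow (p := 1) (by norm_num) x]

variable {F : Type*} [NormedAddCommGroup F] [NormedSpace 𝕜 F] [CompleteSpace F]

theorem summable_lp_one_smul {c : ι → F} {C : ℝ} (hc : ∀ i, ‖c i‖ ≤ C)
    (x : lp (fun _ : ι => 𝕜) 1) : Summable fun i => x i • c i := by
  refine Summable.of_norm_bounded ((summable_norm_lp_one x).mul_right C) fun i => ?_
  rw [norm_smul]
  exact mul_le_mul_of_nonneg_left (hc i) (norm_nonneg _)

/-- The operator on `ℓ¹` with prescribed bounded values at the unit vectors. -/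
noncomputable def lOneLift (c : ι → F) (C : ℝ) (hc : ∀ i, ‖c i‖ ≤ C) :
    lp (fun _ : ι => 𝕜) 1 →L[𝕜] F :=
  LinearMap.mkContinuous
    { toFun := fun x => ∑' i, x i • c i
      map_add' := fun x y => by
        simp only [lp.coeFn_add, Pi.add_apply, add_smul]
        exact (summable_lp_one_smul hc x).tsum_add (summable_lp_one_smul hc y)
      map_smul' := fun r x => by
        simp only [lp.coeFn_smul, Pi.smul_apply, smul_eq_mul, mul_smul, RingHom.id_apply]
        exact (summable_lp_one_smul hc x).tsum_const_smul r } C fun x => by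
    rw [norm_lp_one, mul_comm, ← tsum_mul_right]
    refine tsum_of_norm_bounded ((summable_norm_lp_one x).mul_right C).hasSum fun i => ?_
    rw [norm_smul]
    exact mul_le_mul_of_nonneg_left (hc i) (norm_nonneg _)

theorem lOneLift_single [DecidableEq ι] (c : ι → F) (C : ℝ) (hc : ∀ i, ‖c i‖ ≤ C) (i : ι) (r : 𝕜) :
    lOneLift (𝕜 := 𝕜) c C hc (lp.single 1 i r) = r • c i := by
  change ∑' j, (lp.single 1 i r : lp (fun _ : ι => 𝕜) 1) j • c j = r • c i
  rw [tsum_eq_single i]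
  · simp
  · intro j hj
    rw [lp.single_apply_ne _ _ _ hj, zero_smul]

/-- A bounded matrix defines a bounded bilinear form on `ℓ¹`. -/
theorem exists_lOne_bilinear [DecidableEq ι] (b : ι → ι → 𝕜) (hb : ∀ i j, ‖b i j‖ ≤ 1) :
    ∃ B : lp (fun _ : ι => 𝕜) 1 →L[𝕜] lp (fun _ : ι => 𝕜) 1 →L[𝕜] 𝕜,
      ∀ i j r s, B (lp.single 1 i r) (lp.single 1 j s) = r * (s * b i j) := by
  refine ⟨lOneLift (fun i => lOneLift (b i) 1 (hb i)) 1 fun i =>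
    LinearMap.mkContinuous_norm_le _ zero_le_one _, fun i j r s => ?_⟩
  refine (DFunLike.congr_fun (lOneLift_single (𝕜 := 𝕜) (fun i => lOneLift (b i) 1 (hb i)) 1 _ i r)
    (lp.single 1 j s)).trans ?_
  rw [_root_.smul_apply, lOneLift_single, smul_eq_mul, smul_eq_mul]

end LOne

/-! ### A countable dense set -/

section RationalCombinations

variable (𝕜 ι : Type*) [RCLike 𝕜]

/-- The additive map `(a, b) ↦ a + b i` from pairs of rational numbers. -/
noncomputable def ratPair : ℚ × ℚ →+ 𝕜 where
  toFun q := ((q.1 : ℝ) : 𝕜) + ((q.2 : ℝ) : 𝕜) * RCLike.I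
  map_zero' := by simp
  map_add' q r := by
    simp only [Prod.fst_add, Prod.snd_add, Rat.cast_add, RCLike.ofReal_add]
    ring

theorem denseRange_ratPair : DenseRange (ratPair 𝕜) := by
  have h1 : Function.Surjective fun q : ℝ × ℝ => (q.1 : 𝕜) + (q.2 : 𝕜) * RCLike.I := fun z =>
    ⟨(RCLike.re z, RCLike.im z), RCLike.re_add_im z⟩
  have h2 : Continuous fun q : ℝ × ℝ => (q.1 : 𝕜) + (q.2 : 𝕜) * RCLike.I :=
    (RCLike.continuous_ofReal.comp continuous_fst).add
      ((RCLike.continuous_ofReal.comp continuous_snd).mul continuous_const)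
  exact h1.denseRange.comp
    ((Rat.denseRange_cast (𝕜 := ℝ)).prodMap (Rat.denseRange_cast (𝕜 := ℝ))) h2

/-- The finitely supported functions with rational coefficients. -/
noncomputable def ratFinsupp : (ι →₀ ℚ × ℚ) →+ (ι →₀ 𝕜) :=
  Finsupp.mapRange.addMonoidHom (ratPair 𝕜)

variable {𝕜 ι}

theorem map_mem_closure_ratFinsupp {E : Type*} [AddCommGroup E] [Module 𝕜 E] [TopologicalSpace E]
    [ContinuousAdd E] [ContinuousSMul 𝕜 E] (L : (ι →₀ 𝕜) →ₗ[𝕜] E) (f : ι →₀ 𝕜) :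
    L f ∈ closure (L '' Set.range (ratFinsupp 𝕜 ι)) := by
  classical
  induction f using Finsupp.induction_linear with
  | zero => exact subset_closure ⟨0, ⟨0, map_zero _⟩, rfl⟩
  | add f g hf hg =>
    rw [map_add]
    refine map_mem_closure₂ continuous_add hf hg ?_
    rintro _ ⟨_, ⟨a, rfl⟩, rfl⟩ _ ⟨_, ⟨b, rfl⟩, rfl⟩
    exact ⟨_, ⟨a + b, map_add _ _ _⟩, map_add _ _ _⟩
  | single e c =>
    have hcont : Continuous fun c : 𝕜 => L (Finsupp.single e c) := by
      have : (fun c : 𝕜 => L (Finsupp.single e c)) = fun c => c • L (Finsupp.single e 1) := by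
        funext c
        rw [← map_smul]
        simp
      rw [this]
      exact continuous_id.smul continuous_const
    refine map_mem_closure (f := fun c => L (Finsupp.single e c)) hcont
      (denseRange_ratPair 𝕜 c) ?_
    rintro _ ⟨q, rfl⟩
    exact ⟨_, ⟨Finsupp.single e q, by simp [ratFinsupp]⟩, rfl⟩

end RationalCombinations

/-! ### The Fréchet space of orbits and its backward shift -/

section OrbitSpace

variable {𝕜 V Y : Type*} [RCLike 𝕜] [AddCommGroup V] [Module 𝕜 V]
  [NormedAddCommGroup Y] [NormedSpace 𝕜 Y] (z : V →ₗ[𝕜] V) (j : V →ₗ[𝕜] Y)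

/-- The map `f ↦ (j f, j (z f), j (z² f), …)`. -/
noncomputable def orbitMap : V →ₗ[𝕜] (ℕ → Y) := LinearMap.pi fun k => j ∘ₗ (z ^ k)

@[simp] theorem orbitMap_apply (f : V) (k : ℕ) : orbitMap z j f k = j ((z ^ k) f) := rfl

/-- The closure of the range of `orbitMap` in the countable product. -/
noncomputable def orbitSpace : Submodule 𝕜 (ℕ → Y) :=
  (LinearMap.range (orbitMap z j)).topologicalClosure

/-- `orbitMap` with values in `orbitSpace`. -/
noncomputable def toOrbitSpace : V →ₗ[𝕜] orbitSpace z j :=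
  (orbitMap z j).codRestrict _ fun f =>
    Submodule.le_topologicalClosure _ (LinearMap.mem_range_self _ f)

@[simp] theorem toOrbitSpace_apply (f : V) (k : ℕ) :
    (toOrbitSpace z j f : ℕ → Y) k = j ((z ^ k) f) := rfl

theorem isFrechetSpace_orbitSpace [CompleteSpace Y] : IsFrechetSpace 𝕜 (orbitSpace z j) where
  isUniformAddGroup :=
    inferInstanceAs (IsUniformAddGroup (orbitSpace z j).toAddSubgroup)
  exists_seminorms := by
    have h := withSeminorms_pi (ι := ℕ) fun _ => norm_withSeminorms 𝕜 Y
    have h' := Topology.IsInducing.withSeminorms h (f := (orbitSpace z j).subtype) .subtypeVal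
    exact ⟨_, h'.congr_equiv ((Equiv.sigmaUnique ℕ fun _ => Fin 1).symm)⟩
  t2Space := inferInstance
  completeSpace :=
    (Submodule.isClosed_topologicalClosure _).isComplete.completeSpace_coe

theorem denseRange_toOrbitSpace : DenseRange (toOrbitSpace z j) := by
  intro x
  rw [closure_subtype, ← Set.range_comp]
  exact x.2

theorem dense_image_toOrbitSpace {D : Set V}
    (hD : ∀ f, orbitMap z j f ∈ closure (orbitMap z j '' D)) : Dense (toOrbitSpace z j '' D) := by
  intro x
  rw [closure_subtype, ← Set.image_comp]
  have h : (LinearMap.range (orbitMap z j) : Set (ℕ → Y)) ⊆ closure (orbitMap z j '' D) := by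
    rintro _ ⟨f, rfl⟩
    exact hD f
  exact closure_minimal h isClosed_closure x.2

theorem shift_mem_orbitSpace (x : ℕ → Y) (hx : x ∈ orbitSpace z j) :
    (fun k => x (k + 1)) ∈ orbitSpace z j := by
  have hc : Continuous fun (x : ℕ → Y) (k : ℕ) => x (k + 1) :=
    continuous_pi fun k => continuous_apply (k + 1)
  refine map_mem_closure hc hx ?_
  rintro _ ⟨f, rfl⟩
  refine ⟨z f, ?_⟩
  funext k
  simp [pow_succ]

/-- The backward shift on `orbitSpace`. -/
noncomputable def orbitShift : orbitSpace z j →L[𝕜] orbitSpace z j where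
  toFun x := ⟨fun k => (x : ℕ → Y) (k + 1), shift_mem_orbitSpace z j x x.2⟩
  map_add' _ _ := rfl
  map_smul' _ _ := rfl
  cont := by
    have h : Continuous fun (x : orbitSpace z j) (k : ℕ) => (x : ℕ → Y) (k + 1) :=
      continuous_pi fun k => (continuous_apply (k + 1)).comp continuous_subtype_val
    exact h.subtype_mk _

theorem orbitShift_toOrbitSpace (f : V) :
    orbitShift z j (toOrbitSpace z j f) = toOrbitSpace z j (z f) := by
  refine Subtype.ext (funext fun k => ?_)
  change j ((z ^ (k + 1)) f) = j ((z ^ k) (z f))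
  rw [pow_succ, Module.End.mul_apply]

theorem orbitShift_iterate_toOrbitSpace (n : ℕ) (f : V) :
    (orbitShift z j)^[n] (toOrbitSpace z j f) = toOrbitSpace z j ((z ^ n) f) := by
  induction n with
  | zero => rfl
  | succ n ih =>
    rw [Function.iterate_succ_apply', ih, orbitShift_toOrbitSpace, pow_succ', Module.End.mul_apply]

theorem not_finiteDimensional_orbitSpace (hj : Function.Injective j)
    (hV : ¬ FiniteDimensional 𝕜 V) : ¬ FiniteDimensional 𝕜 (orbitSpace z j) := by
  intro h
  refine hV (FiniteDimensional.of_injective (toOrbitSpace z j) fun f g hfg => hj ?_)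
  exact congrFun (congrArg Subtype.val hfg) 0

/-- The neighbourhoods of a point of the image of `V`. -/
theorem exists_ball_subset {U : Set (orbitSpace z j)} (hU : IsOpen U) {p : V}
    (hp : toOrbitSpace z j p ∈ U) : ∃ K : ℕ, ∃ δ > 0, ∀ x : V,
      (∀ k ≤ K, ‖j ((z ^ k) (x - p))‖ < δ) → toOrbitSpace z j x ∈ U := by
  obtain ⟨U', hU', rfl⟩ := isOpen_induced_iff.1 hU
  obtain ⟨I, u, hu, hIu⟩ := isOpen_pi_iff.1 hU' _ hp
  have hδ : ∀ k ∈ I, ∃ δ > 0, Metric.ball (j ((z ^ k) p)) δ ⊆ u k := fun k hk =>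
    Metric.isOpen_iff.1 (hu k hk).1 _ (hu k hk).2
  choose! δ hδ0 hδ using hδ
  obtain ⟨δ₀, hδ₀, hle⟩ : ∃ δ₀ > 0, ∀ k ∈ I, δ₀ ≤ δ k := by
    rcases I.eq_empty_or_nonempty with rfl | hI
    · exact ⟨1, one_pos, by simp⟩
    · exact ⟨I.inf' hI δ, (Finset.lt_inf'_iff hI).2 hδ0, fun k hk => Finset.inf'_le _ hk⟩
  refine ⟨I.sup id, δ₀, hδ₀, fun x hx => hIu fun k hk => hδ k hk ?_⟩
  rw [Metric.mem_ball, dist_eq_norm]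
  refine lt_of_lt_of_le ?_ (hle k hk)
  have := hx k (Finset.le_sup (f := id) hk)
  rwa [map_sub, map_sub] at this

theorem isFrequentlyTransitive_orbitShift {D : Set V} (hD : Dense (toOrbitSpace z j '' D))
    (h : ∀ p ∈ D, ∀ q ∈ D, ∀ K : ℕ, ∀ δ > 0, ∀ B : Set ℕ,
      (∀ n x, (∀ k ≤ K, ‖j ((z ^ k) (x - p))‖ < δ) →
        (∀ k ≤ K, ‖j ((z ^ k) ((z ^ n) x - q))‖ < δ) → n ∈ B) → 0 < lowerDensity B) :
    IsFrequentlyTransitive (orbitShift z j) := by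
  intro U W hU hU' hW hW'
  obtain ⟨_, hpU, p, hp, rfl⟩ := hD.inter_open_nonempty U hU hU'
  obtain ⟨_, hqW, q, hq, rfl⟩ := hD.inter_open_nonempty W hW hW'
  obtain ⟨K₁, δ₁, hδ₁, h₁⟩ := exists_ball_subset z j hU hpU
  obtain ⟨K₂, δ₂, hδ₂, h₂⟩ := exists_ball_subset z j hW hqW
  refine h p hp q hq (max K₁ K₂) (min δ₁ δ₂) (lt_min hδ₁ hδ₂) _ fun n x hx hx' => ?_
  refine ⟨toOrbitSpace z j ((z ^ n) x), ⟨toOrbitSpace z j x, ?_, ?_⟩, ?_⟩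
  · exact h₁ x fun k hk => (hx k (le_max_of_le_left hk)).trans_le (min_le_left _ _)
  · exact orbitShift_iterate_toOrbitSpace z j n x
  · exact h₂ _ fun k hk => (hx' k (le_max_of_le_right hk)).trans_le (min_le_right _ _)

/-- A nonzero continuous bilinear form for which the operator is symmetric prevents it from being
weakly mixing. -/
theorem not_isWeaklyMixing_of_bilinear {X : Type*} [AddCommGroup X] [Module 𝕜 X]
    [TopologicalSpace X] (T : X →L[𝕜] X) (β : X → X → 𝕜)
    (hβ : Continuous fun p : X × X => β p.1 p.2) (hT : ∀ x y, β (T x) y = β x (T y))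
    (hl : ∀ y, β 0 y = 0) {a b : X} (hab : β a b ≠ 0) :
    ¬ IsWeaklyMixing T := by
  rintro ⟨⟨x, y⟩, h⟩
  have hiter : ∀ n u v, β (T^[n] u) v = β u (T^[n] v) := by
    intro n
    induction n with
    | zero => exact fun _ _ => rfl
    | succ n ih =>
      intro u v
      rw [Function.iterate_succ_apply, ih, hT, Function.iterate_succ_apply']
  have horb : ∀ n, (T.prodMap T)^[n] (x, y) = (T^[n] x, T^[n] y) := by
    intro n
    induction n with
    | zero => rfl
    | succ n ih =>
      rw [Function.iterate_succ_apply', ih, Function.iterate_succ_apply',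
        Function.iterate_succ_apply']
      rfl
  have hc1 : ∀ v, Continuous fun u => β u v := fun v =>
    hβ.comp (continuous_id.prodMk continuous_const)
  have hc2 : ∀ u, Continuous fun v => β u v := fun u =>
    hβ.comp (continuous_const.prodMk continuous_id)
  -- By symmetry the equality holds along the dense orbit of (x, y), hence everywhere. Its two sides
  -- depend on different variables, so taking p.1 = 0 gives β x = 0.
  have hxy : ∀ p : X × X, β p.1 y = β x p.2 := by
    intro p
    by_contra hne
    have hopen : IsOpen {p : X × X | β p.1 y ≠ β x p.2} :=
      isOpen_ne_fun ((hc1 y).comp continuous_fst) ((hc2 x).comp continuous_snd)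
    obtain ⟨n, hn⟩ := h _ hopen ⟨p, hne⟩
    simp only [returnTimes, Set.mem_ofPred_eq, horb] at hn
    exact hn (hiter n x y)
  have hx : ∀ v, β x v = 0 := fun v => by rw [← hxy (0, v), hl]
  have hopen : IsOpen {p : X × X | β p.1 b ≠ 0} :=
    isOpen_ne_fun ((hc1 b).comp continuous_fst) continuous_const
  obtain ⟨n, hn⟩ := h _ hopen ⟨(a, 0), hab⟩
  simp only [returnTimes, Set.mem_ofPred_eq, horb] at hn
  exact hn (by rw [hiter, hx])

/-- The form is evaluated on zeroth coordinates; its symmetry extends from the image of V by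
density. -/
theorem not_isWeaklyMixing_orbitShift (B : Y →L[𝕜] Y →L[𝕜] 𝕜)
    (hB : ∀ f g, B (j (z f)) (j g) = B (j f) (j (z g))) {f g : V} (hfg : B (j f) (j g) ≠ 0) :
    ¬ IsWeaklyMixing (orbitShift z j) := by
  have hc : ∀ k l : ℕ, Continuous fun p : orbitSpace z j × orbitSpace z j =>
      B ((p.1 : ℕ → Y) k) ((p.2 : ℕ → Y) l) := fun k l =>
    (B.continuous.comp
      ((continuous_apply k).comp (continuous_subtype_val.comp continuous_fst))).clm_apply
        ((continuous_apply l).comp (continuous_subtype_val.comp continuous_snd))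
  refine not_isWeaklyMixing_of_bilinear (orbitShift z j)
    (fun x y => B ((x : ℕ → Y) 0) ((y : ℕ → Y) 0)) (hc 0 0) (fun x y => ?_)
    (fun y => by simp) (a := toOrbitSpace z j f) (b := toOrbitSpace z j g) hfg
  have hd : DenseRange (Prod.map (toOrbitSpace z j) (toOrbitSpace z j)) :=
    (denseRange_toOrbitSpace z j).prodMap (denseRange_toOrbitSpace z j)
  refine congrFun (hd.equalizer (hc 1 0) (hc 0 1) ?_) (x, y)
  funext p
  exact hB p.1 p.2

end OrbitSpace

/-! ### Assembly of the construction -/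

theorem exists_isAdmissible {𝕜 : Type*} [Field 𝕜] (R : ℕ → (ℕ × ℕ →₀ 𝕜) × (ℕ × ℕ →₀ 𝕜)) :
    ∃ (P Q : ℕ → (ℕ × ℕ →₀ 𝕜)) (act : Set ℕ) (k : ℕ → ℕ), IsAdmissible P Q act k ∧
      ∀ (i N : ℕ) (B : Set ℕ),
        (∀ n ∈ act, k n = i → P n = (R i).1 → Q n = (R i).2 → N ≤ n → n ∈ B) →
          0 < lowerDensity B := by
  classical
  obtain ⟨lev, hlev⟩ := exists_syndetic_coloring
  -- Active indices of colour i exceed `J i`, so this threshold yields at once lowerness and the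
  -- degree bounds with margin 2i.
  set J : ℕ → ℕ := fun i => 2 * i + (R i).1.support.sup (fun e => e.1 + e.2) +
    (R i).2.support.sup (fun e => e.1 + e.2) with hJ
  have hJ1 : ∀ i, ∀ e ∈ (R i).1.support, e.1 + e.2 + 2 * i ≤ J i := fun i e he => by
    have := Finset.le_sup (f := fun e : ℕ × ℕ => e.1 + e.2) he
    simp only [hJ]
    omega
  have hJ2 : ∀ i, ∀ e ∈ (R i).2.support, e.1 + e.2 + 2 * i ≤ J i := fun i e he => by
    have := Finset.le_sup (f := fun e : ℕ × ℕ => e.1 + e.2) he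
    simp only [hJ]
    omega
  set act : Set ℕ := {n | ∃ i, n ∈ levelSet lev J i} with hact
  have hk : ∃ k : ℕ → ℕ, ∀ n ∈ act, n ∈ levelSet lev J (k n) := by
    choose! k hk using fun n (hn : n ∈ act) => hn
    exact ⟨k, hk⟩
  obtain ⟨k, hk⟩ := hk
  refine ⟨fun n => if n ∈ act then (R (k n)).1 else 0, fun n => if n ∈ act then (R (k n)).2 else 0,
    act, k, ⟨?_, ?_, ?_, ?_, ?_, ?_⟩, ?_⟩
  · intro n e he
    dsimp only at he
    split_ifs at he with hn
    · have := hJ1 _ e he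
      have := (lt_of_mem_levelSet (hk n hn)).1
      omega
    · simp at he
  · intro n e he
    dsimp only at he
    split_ifs at he with hn
    · have := hJ2 _ e he
      have := (lt_of_mem_levelSet (hk n hn)).1
      omega
    · simp at he
  · intro n hn e he
    rw [if_pos hn] at he
    have := hJ1 _ e he
    have := (lt_of_mem_levelSet (hk n hn)).1
    omega
  · intro n hn e he
    rw [if_pos hn] at he
    have := hJ2 _ e he
    have := (lt_of_mem_levelSet (hk n hn)).1
    omega
  · exact fun n hn n' hn' h => levelSet_separated (hk n hn) (hk n' hn') h
  · exact fun n hn => (lt_of_mem_levelSet (hk n hn)).2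
  · intro i N B hB
    obtain ⟨L, hL⟩ := hlev i
    refine lowerDensity_pos_of_levelSet hL J N fun n hn hN => ?_
    have hn' : n ∈ act := ⟨i, hn⟩
    have hki : k n = i := levelSet_disjoint (hk n hn') hn
    exact hB n hn' hki (by simp only [if_pos hn', hki]) (by simp only [if_pos hn', hki]) hN

/-- The Fréchet space and the operator obtained from an embedding of a module in a Banach space. -/
theorem exists_orbitSpace {𝕜 V Y : Type} [RCLike 𝕜] [AddCommGroup V] [Module 𝕜 V]
    [NormedAddCommGroup Y] [NormedSpace 𝕜 Y] [CompleteSpace Y] (z : V →ₗ[𝕜] V) (j : V →ₗ[𝕜] Y)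
    {D : Set V} (hDc : D.Countable) (hD : ∀ f, orbitMap z j f ∈ closure (orbitMap z j '' D))
    (hj : Function.Injective j) (hV : ¬ FiniteDimensional 𝕜 V)
    (h : ∀ p ∈ D, ∀ q ∈ D, ∀ K : ℕ, ∀ δ > 0, ∀ A : Set ℕ,
      (∀ n x, (∀ k ≤ K, ‖j ((z ^ k) (x - p))‖ < δ) →
        (∀ k ≤ K, ‖j ((z ^ k) ((z ^ n) x - q))‖ < δ) → n ∈ A) → 0 < lowerDensity A)
    (B : Y →L[𝕜] Y →L[𝕜] 𝕜) (hB : ∀ f g, B (j (z f)) (j g) = B (j f) (j (z g))) {f g : V}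
    (hfg : B (j f) (j g) ≠ 0) :
    ∃ (X : Type) (_ : AddCommGroup X) (_ : Module 𝕜 X) (_ : UniformSpace X),
      IsFrechetSpace 𝕜 X ∧ TopologicalSpace.SeparableSpace X ∧ ¬ FiniteDimensional 𝕜 X ∧
      ∃ T : X →L[𝕜] X, IsFrequentlyTransitive T ∧ ¬ IsWeaklyMixing T :=
  have hdense := dense_image_toOrbitSpace z j hD
  ⟨orbitSpace z j, inferInstance, inferInstance, inferInstance, isFrechetSpace_orbitSpace z j,
    ⟨_, hDc.image _, hdense⟩, not_finiteDimensional_orbitSpace z j hj hV, orbitShift z j,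
    isFrequentlyTransitive_orbitShift z j hdense h, not_isWeaklyMixing_orbitShift z j B hB hfg⟩

section WeightedEmbedding

variable {𝕜 ι : Type*} [RCLike 𝕜] [DecidableEq ι]

/-- The map from finitely supported functions to `ℓ¹` with weights `w`. -/
noncomputable def weightedMap (w : ι → ℝ) : (ι →₀ 𝕜) →ₗ[𝕜] lp (fun _ : ι => 𝕜) 1 :=
  Finsupp.linearCombination 𝕜 fun e => lp.single 1 e (w e : 𝕜)

theorem weightedMap_single (w : ι → ℝ) (e : ι) (c : 𝕜) :
    weightedMap w (Finsupp.single e c) = c • lp.single 1 e (w e : 𝕜) := by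
  simp [weightedMap]

theorem weightedMap_apply (w : ι → ℝ) (f : ι →₀ 𝕜) (e : ι) :
    (weightedMap w f : ι → 𝕜) e = f e * w e := by
  induction f using Finsupp.induction_linear with
  | zero => simp
  | add f g hf hg => rw [map_add, lp.coeFn_add, Pi.add_apply, hf, hg, Finsupp.add_apply, add_mul]
  | single i c =>
    rw [weightedMap_single, lp.coeFn_smul, Pi.smul_apply, smul_eq_mul]
    by_cases h : e = i
    · subst h
      simp
    · rw [lp.single_apply_ne _ _ _ h, Finsupp.single_eq_of_ne h, mul_zero, zero_mul]

theorem weightedMap_injective {w : ι → ℝ} (hw : ∀ e, 0 < w e) :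
    Function.Injective (weightedMap (𝕜 := 𝕜) w) := by
  intro f g hfg
  ext e
  have h := congrArg (fun x : lp (fun _ : ι => 𝕜) 1 => (x : ι → 𝕜) e) hfg
  simp only [weightedMap_apply] at h
  exact mul_right_cancel₀ (RCLike.ofReal_ne_zero.2 (hw e).ne') h

theorem exists_bilinear_weightedMap {w : ι → ℝ} (hw : ∀ e, 0 < w e)
    (φ : (ι →₀ 𝕜) →ₗ[𝕜] (ι →₀ 𝕜) →ₗ[𝕜] 𝕜)
    (hφ : ∀ d e, ‖φ (Finsupp.single d 1) (Finsupp.single e 1)‖ ≤ w d * w e) :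
    ∃ B : lp (fun _ : ι => 𝕜) 1 →L[𝕜] lp (fun _ : ι => 𝕜) 1 →L[𝕜] 𝕜,
      ∀ f g, B (weightedMap w f) (weightedMap w g) = φ f g := by
  have hw' : ∀ e, (w e : 𝕜) ≠ 0 := fun e => RCLike.ofReal_ne_zero.2 (hw e).ne'
  obtain ⟨B, hB⟩ := exists_lOne_bilinear
    (fun d e => φ (Finsupp.single d 1) (Finsupp.single e 1) / ((w d : 𝕜) * (w e : 𝕜)))
    fun d e => by
      rw [norm_div, norm_mul, RCLike.norm_ofReal, RCLike.norm_ofReal, abs_of_pos (hw d),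
        abs_of_pos (hw e)]
      exact div_le_one_of_le₀ (hφ d e) (mul_pos (hw d) (hw e)).le
  refine ⟨B, fun f g => ?_⟩
  induction f using Finsupp.induction_linear with
  | zero => simp
  | add f f' hf hf' => simp only [map_add, LinearMap.add_apply, add_apply, hf, hf']
  | single d c =>
    induction g using Finsupp.induction_linear with
    | zero => simp
    | add g g' hg hg' => simp only [map_add, hg, hg']
    | single e c' =>
      have h1 : (Finsupp.single d c : ι →₀ 𝕜) = c • Finsupp.single d 1 := by simp
      have h2 : (Finsupp.single e c' : ι →₀ 𝕜) = c' • Finsupp.single e 1 := by simp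
      rw [weightedMap_single, weightedMap_single, ← lp.single_smul, ← lp.single_smul, hB, h1, h2,
        map_smul, map_smul, LinearMap.smul_apply]
      simp only [smul_eq_mul]
      field_simp [hw' d, hw' e]

end WeightedEmbedding

/-- The free module embeds in `ℓ¹` in such a way that the form is continuous and the adapted basis
vectors indexed by `smallSet` are small. -/
theorem exists_embedding_lOne {𝕜 : Type*} [RCLike 𝕜] {P Q : ℕ → (ℕ × ℕ →₀ 𝕜)} {act : Set ℕ}
    {k : ℕ → ℕ} (hadm : IsAdmissible P Q act k) :
    ∃ (j : (ℕ × ℕ →₀ 𝕜) →ₗ[𝕜] lp (fun _ : ℕ × ℕ => 𝕜) 1)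
      (B : lp (fun _ : ℕ × ℕ => 𝕜) 1 →L[𝕜] lp (fun _ : ℕ × ℕ => 𝕜) 1 →L[𝕜] 𝕜),
      Function.Injective j ∧ (∀ f g, B (j f) (j g) = form P Q f g) ∧
        ∀ e ∈ smallSet act k, ‖j (basisVec P Q e)‖ = 1 / ((e.1 : ℝ) + 1) := by
  have hP := hadm.isLower_left
  have hQ := hadm.isLower_right
  obtain ⟨w, hw, hwS, hwb⟩ := exists_weight
    (fun d e => ‖form P Q (basisVec P Q d) (basisVec P Q e)‖) (fun _ _ => norm_nonneg _)
    (fun d e => by rw [form_comm]) (smallSet act k)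
    (fun d hd e he => norm_eq_zero.2 (hadm.form_smallSet hd he))
    (fun d => by simpa only [ne_eq, norm_eq_zero] using hadm.finite_form_ne_zero d)
    (fun e => 1 / ((e.1 : ℝ) + 1)) (fun e => by positivity)
  obtain ⟨B, hB⟩ := exists_bilinear_weightedMap hw
    ((form P Q).compl₁₂ (synth P Q) (synth P Q)) (fun d e => by
      simpa only [LinearMap.compl₁₂_apply, synth_single, one_smul] using hwb d e)
  refine ⟨weightedMap w ∘ₗ coords P Q, B,
    (weightedMap_injective hw).comp (Function.LeftInverse.injective (synth_coords hP hQ)),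
    fun f g => ?_, fun e he => ?_⟩
  · rw [LinearMap.comp_apply, LinearMap.comp_apply, hB, LinearMap.compl₁₂_apply,
      synth_coords hP hQ, synth_coords hP hQ]
  · rw [LinearMap.comp_apply, coords_basisVec hP hQ, weightedMap_single, one_smul,
      lp.norm_single (by norm_num), RCLike.norm_ofReal, abs_of_pos (hw e), hwS e he]

theorem not_finiteDimensional_finsupp (𝕜 ι : Type*) [Field 𝕜] [Infinite ι] :
    ¬ FiniteDimensional 𝕜 (ι →₀ 𝕜) := fun _ =>
  not_finite_iff_infinite.2 ‹Infinite ι›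
    (Module.Finite.finite_basis (Finsupp.basisSingleOne (R := 𝕜) (ι := ι)))

/-- There is an embedding of the free module in `ℓ¹` for which the shift satisfies the criterion for
frequent transitivity and is symmetric for a nonzero bounded bilinear form. -/
theorem exists_frequentlyTransitive_embedding {𝕜 : Type*} [RCLike 𝕜] {D : Set (ℕ × ℕ →₀ 𝕜)}
    (hDc : D.Countable) (hDn : D.Nonempty) :
    ∃ (j : (ℕ × ℕ →₀ 𝕜) →ₗ[𝕜] lp (fun _ : ℕ × ℕ => 𝕜) 1)
      (B : lp (fun _ : ℕ × ℕ => 𝕜) 1 →L[𝕜] lp (fun _ : ℕ × ℕ => 𝕜) 1 →L[𝕜] 𝕜),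
      Function.Injective j ∧ (∀ f g, B (j (shift f)) (j g) = B (j f) (j (shift g))) ∧
      (∃ f g, B (j f) (j g) ≠ 0) ∧
      ∀ p ∈ D, ∀ q ∈ D, ∀ K : ℕ, ∀ δ > 0, ∀ A : Set ℕ,
        (∀ n x, (∀ k ≤ K, ‖j ((shift ^ k) (x - p))‖ < δ) →
          (∀ k ≤ K, ‖j ((shift ^ k) ((shift ^ n) x - q))‖ < δ) → n ∈ A) → 0 < lowerDensity A := by
  obtain ⟨enum, henum⟩ := (hDc.prod hDc).exists_eq_range (hDn.prod hDn)
  -- Each pair (p, q) is repeated for all second components K; the colour `Nat.pair c K` is at least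
  -- K, so its window is wide enough for precision K.
  obtain ⟨P, Q, act, k, hadm, hdens⟩ := exists_isAdmissible fun i => enum i.unpair.1
  obtain ⟨j, B, hj, hBj, hjb⟩ := exists_embedding_lOne hadm
  refine ⟨j, B, hj, fun f g => by rw [hBj, hBj, form_shift],
    ⟨Finsupp.single (0, 0) 1, Finsupp.single (0, 0) 1, ?_⟩, ?_⟩
  · rw [hBj, form_single_single, formCoeff_zero]
    simp
  intro p hp q hq K δ hδ A hA
  obtain ⟨c, hc⟩ : (p, q) ∈ Set.range enum := henum ▸ ⟨hp, hq⟩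
  obtain ⟨N, hN⟩ := exists_nat_one_div_lt hδ
  refine hdens (Nat.pair c K) N A fun n hn hkn hPn hQn hNn => ?_
  simp only [Nat.unpair_pair, hc] at hPn hQn
  have hK : K ≤ k n := hkn ▸ Nat.right_le_pair c K
  have hkn' := hadm.window_lt n hn
  have hsmall : 1 / ((n : ℝ) + 1) < δ := by
    refine lt_of_le_of_lt ?_ hN
    gcongr
  -- The witness is the generator e_n: e_n - p and z^n e_n - q are the adapted basis vectors at (n,
  -- 0) and (n, n), and their first K shifts stay in `smallSet`.
  refine hA n (Finsupp.single (n, 0) 1) (fun l hl => ?_) fun l hl => ?_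
  · have h : Finsupp.single (n, 0) 1 - p = basisVec P Q (n, 0) := by
      rw [basisVec, reduct, if_pos (by omega), pow_zero, Module.End.one_apply, hPn]
    rw [h, basisVec_eq_shift_of_lt (by omega),
      hjb _ ⟨hn, Or.inl (by dsimp only; omega)⟩]
    exact hsmall
  · have h : (shift ^ n) (Finsupp.single (n, 0) 1) - q = basisVec P Q (n, n) := by
      rw [basisVec, reduct, if_neg (by simp), shift_pow_single, zero_add, Nat.sub_self, pow_zero,
        Module.End.one_apply, hQn]
    rw [h, basisVec_eq_shift_of_le le_rfl,
      hjb _ ⟨hn, Or.inr ⟨by dsimp only; omega, by dsimp only; omega⟩⟩]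
    exact hsmall

end LinearDynamics

theorem theorem5p6 (𝕜 : Type) [RCLike 𝕜] :
    ∃ (X : Type) (_ : AddCommGroup X) (_ : Module 𝕜 X) (_ : UniformSpace X),
      LinearDynamics.IsFrechetSpace 𝕜 X ∧ TopologicalSpace.SeparableSpace X ∧
      ¬ FiniteDimensional 𝕜 X ∧
      ∃ T : X →L[𝕜] X,
        LinearDynamics.IsFrequentlyTransitive T ∧ ¬ LinearDynamics.IsWeaklyMixing T := by
  have hDc : (Set.range (LinearDynamics.ratFinsupp 𝕜 (ℕ × ℕ))).Countable := Set.countable_range _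
  obtain ⟨j, B, hj, hB, ⟨f, g, hfg⟩, h⟩ :=
    LinearDynamics.exists_frequentlyTransitive_embedding hDc (Set.range_nonempty _)
  exact LinearDynamics.exists_orbitSpace LinearDynamics.shift j hDc
    (fun f => LinearDynamics.map_mem_closure_ratFinsupp _ f) hj
    (LinearDynamics.not_finiteDimensional_finsupp 𝕜 _) h B hB hfg
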